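/- **Proposition 3.4.** There is a universal constant $c_1>0$ with the following property. Let $0\le t\le s\le 1/2$. Let $(G,d)$ be a separable strongly left-invariant metric semigroup, i.e. a semigroup with a separable metric $d$ such that $d(ca,cb)=d(a,b)$ and $d(a,ab)=d(b,b^2)$ for all $a,b,c\in G$. Let $z_0,z_1\in G$, $n\ge 1$, and let $X_1,\dots,X_n$ be independent $G$-valued (Borel) random variables on a probability space, such that the products of consecutive variables are again random variables: for $1\le i\le j\le n$, $X_iX_{i+1}\cdots X_j$ is measurable with respect to $\sigma(X_i,\dots,X_j)$ (automatic if the multiplication $G\times G\to G$ is Borel measurable). Put $S_j:=X_1X_2\cdots X_j$, $$U_n:=\max_{1\le j\le n}d(z_1,z_0S_j),\qquad M_n:=\max_{1\le j\le n}d(z_0,z_0X_j),$$ and for a nonnegative random variable $Z$ and $t\in[0,1]$ let $$Z^*(t):=\sup\{y\in[0,\infty):\mathbb P(Z>y)>t\}\in[0,\infty]\qquad(\sup\emptyset:=0).$$ Then $$U_n^*(t)\le c_1\,\frac{\log(1/t)}{\max\{\log(1/s),\,\log\log(4/t)\}}\,\bigl(U_n^*(s)+M_n^*(t/2)\bigr),$$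 where for $t=0$ the quotient is read as $+\infty$, with $\infty\cdot 0=0$. -/

import Mathlib

open MeasureTheory ProbabilityTheory
open scoped ENNReal NNReal

/-- The metric of the semigroup `G` is strongly left-invariant. -/
class IsStronglyLeftInvariant (G : Type*) [Semigroup G] [MetricSpace G] : Prop where
  dist_mul_left' : ∀ a b c : G, dist (c * a) (c * b) = dist a b
  dist_self_mul' : ∀ a b : G, dist a (a * b) = dist b (b * b)

/-- The product `x i * x (i + 1) * ⋯ * x (i + k)` of `k + 1` consecutive terms of a sequence in a
semigroup (which need not have an identity). -/
def segProd {G : Type*} [Semigroup G] (x : ℕ → G) (i : ℕ) : ℕ → G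
  | 0 => x i
  | k + 1 => segProd x i k * x (i + (k + 1))

/-- The variables `X₁, …, Xₙ` are `X 0, …, X (n - 1)`, so that `S_{k+1} = X 0 * ⋯ * X k`. -/
def partialProd {Ω G : Type*} [Semigroup G] (X : ℕ → Ω → G) (k : ℕ) (ω : Ω) : G :=
  segProd (fun l => X l ω) 0 k

/-- `U_n = max_{1 ≤ j ≤ n} d(z₁, z₀ S_j)`. -/
noncomputable def maxU {Ω G : Type*} [Semigroup G] [MetricSpace G] (z₀ z₁ : G)
    (X : ℕ → Ω → G) (n : ℕ) (ω : Ω) : ℝ :=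
  ⨆ k : Fin n, dist z₁ (z₀ * partialProd X k ω)

/-- `M_n = max_{1 ≤ j ≤ n} d(z₀, z₀ X_j)`. -/
noncomputable def maxM {Ω G : Type*} [Semigroup G] [MetricSpace G] (z₀ : G)
    (X : ℕ → Ω → G) (n : ℕ) (ω : Ω) : ℝ :=
  ⨆ k : Fin n, dist z₀ (z₀ * X k ω)

/-- Products of consecutive variables among `X 0, …, X (n - 1)` are again random variables:
`X i * ⋯ * X (i + k)` is measurable with respect to the σ-algebra generated by its factors.
This is automatic if the multiplication of `G` is Borel measurable, and for countably valued
variables; for a merely left-invariant metric, right translations need not be Borel, and then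
the events `{U_n > y}` need not have a probability. -/
def ProductsMeasurable {Ω G : Type*} [Semigroup G] [mG : MeasurableSpace G]
    (X : ℕ → Ω → G) (n : ℕ) : Prop :=
  ∀ i k : ℕ, i + k < n →
    Measurable[⨆ l ∈ Finset.Icc i (i + k), MeasurableSpace.comap (X l) mG]
      (fun ω => segProd (fun l => X l ω) i k)

/-- The condition `ProductsMeasurable` is automatic for a Borel measurable multiplication. -/
theorem productsMeasurable_of_measurableMul₂ {Ω G : Type*} [Semigroup G]
    [mG : MeasurableSpace G] [MeasurableMul₂ G] (X : ℕ → Ω → G) (n : ℕ) :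
    ProductsMeasurable X n := by
  intro i k _
  induction k with
  | zero =>
    exact (comap_measurable (X i)).mono
      (le_iSup₂_of_le i (by simp) le_rfl) le_rfl
  | succ k ih =>
    refine @Measurable.mul G Ω _ _ _ (_) _ _ ((ih (by omega)).mono ?_ le_rfl)
      ((comap_measurable (X (i + (k + 1)))).mono
        (le_iSup₂_of_le (i + (k + 1)) (by simp) le_rfl) le_rfl)
    exact biSup_mono fun l hl => by
      rw [Finset.mem_Icc] at hl ⊢; omega

/-- The decreasing rearrangement `Z*(t) = sup {y ∈ [0, ∞) : P(Z > y) > t}` of a nonnegative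
random variable, with values in `[0, ∞]` (`sup ∅ = 0`; the value `∞` is only possible at
`t = 0`, where `Z*(0)` is the essential supremum). -/
noncomputable def decRearrangement {Ω : Type*} [MeasurableSpace Ω] (μ : Measure Ω)
    (Z : Ω → ℝ) (t : ℝ) : ℝ≥0∞ :=
  ⨆ (y : ℝ≥0) (_ : ENNReal.ofReal t < μ {ω | (y : ℝ) < Z ω}), (y : ℝ≥0∞)

/-- The factor `log(1/t) / max {log(1/s), log log(4/t)}`, read as `∞` at `t = 0`. -/
noncomputable def logFactor (t s : ℝ) : ℝ≥0∞ :=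
  if t = 0 then ∞
  else ENNReal.ofReal
    (Real.log (1 / t) / max (Real.log (1 / s)) (Real.log (Real.log (4 / t))))

/-!
The proof is a Hoffmann-Jørgensen argument with a factorial gain. Write `N(b) = d(b, b²)` for the
displacement of `b`. Strong left-invariance gives `d(a, ab) = N(b)` for every `a`, so `N` is
subadditive and measures how far a block of consecutive factors moves the product, whatever
precedes the block.

Put `A = U_n*(s) + M_n*(t/2)`. Since `{U_n ≤ U_n*(s)}` and `{M_n ≤ M_n*(t/2)}` have probabilities
summing to more than `1`, they meet, and so `d(z₁, z₀) ≤ A`. If all steps are at most `A`, then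
`U_n > (3K + 1) A` forces the path to make `K` successive excursions, each leaving the
`2A`-neighbourhood of the point where it starts (`setOf_lt_maxU_subset`).

Let `u_i` be the probability that the first `i` products stay within distance `A` of `z₁`, and
`q = u_n`. A path that has stayed there up to time `i` and then moves by more than `2A` leaves the
ball, so by independence an excursion from `i` ends by time `j` with probability at most
`(u_i - u_j) / q`. The distribution of the end of the excursion is thus dominated by that of the
exit from the ball, and an induction on `r`, with a Stieltjes sum compared to `∫ x ^ r / r!`
(`sum_sub_mul_pow_div_factorial_le`), bounds the probability of `r` excursions from `i` by
`((u_i - q) / q) ^ r / r!` (`measureReal_excursionSet_le`). For `i = 0` this gives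
`P(U_n > (3K + 1) A) ≤ P(M_n > A) + (s / (1 - s)) ^ K / K!` (`measureReal_lt_maxU_le`).

The last term is at most `t / 2` once `K` is `18` times the logarithmic factor
(`odds_pow_div_factorial_le`): the power takes care of `log (1 / s)`, the factorial of
`log log (4 / t)`. For `t = 0` only the case `A = 0` has content, and there `K → ∞`.
-/

/-! ### Divided powers and logarithms -/

lemma succ_mul_sub_mul_pow_le {x y : ℝ} (hy : 0 ≤ y) (hxy : y ≤ x) (r : ℕ) :
    (r + 1) * ((x - y) * y ^ r) ≤ x ^ (r + 1) - y ^ (r + 1) := by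
  induction r with
  | zero => simp
  | succ r ih =>
    have h1 : y * ((r + 1) * ((x - y) * y ^ r)) ≤ x * (x ^ (r + 1) - y ^ (r + 1)) := by
      refine mul_le_mul hxy ih ?_ (hy.trans hxy)
      have := sub_nonneg.2 hxy
      positivity
    push_cast
    have e1 : x ^ (r + 1 + 1) = x * x ^ (r + 1) := pow_succ' _ _
    have e2 : y ^ (r + 1 + 1) = y * y ^ (r + 1) := pow_succ' _ _
    have e3 : y ^ (r + 1) = y * y ^ r := pow_succ' _ _
    rw [e1, e2]
    rw [e3] at h1 ⊢
    linarith

lemma sub_mul_pow_div_factorial_le {x y : ℝ} (hy : 0 ≤ y) (hxy : y ≤ x) (r : ℕ) :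
    (x - y) * (y ^ r / r.factorial) ≤
      x ^ (r + 1) / (r + 1).factorial - y ^ (r + 1) / (r + 1).factorial := by
  have h := succ_mul_sub_mul_pow_le hy hxy r
  have hr : (0 : ℝ) < r.factorial := by positivity
  rw [← sub_div, Nat.factorial_succ, Nat.cast_mul, le_div_iff₀ (by positivity)]
  have : (x - y) * (y ^ r / r.factorial) * (((r + 1 : ℕ) : ℝ) * r.factorial) =
      (r + 1) * ((x - y) * y ^ r) := by
    push_cast
    field_simp
  rw [this]
  exact h

/-- A Stieltjes sum of the decreasing function `v ^ r / r!` against `b` is at most the one against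
the larger function `v 0 - v`, which is a lower Riemann sum of `∫ x ^ r / r!`. -/
lemma sum_sub_mul_pow_div_factorial_le (v b : ℕ → ℝ) (r m : ℕ)
    (hanti : ∀ k < m, v (k + 1) ≤ v k) (hv : ∀ k ≤ m, 0 ≤ v k) (hb0 : b 0 = 0)
    (hb : ∀ k ≤ m, b k ≤ v 0 - v k) :
    ∑ k ∈ Finset.range m, (b (k + 1) - b k) * (v (k + 1) ^ r / r.factorial) ≤
      v 0 ^ (r + 1) / (r + 1).factorial := by
  -- the two error terms come from Abel summation and make the induction on `m` work
  have key : ∑ k ∈ Finset.range m, (b (k + 1) - b k) * (v (k + 1) ^ r / r.factorial) ≤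
      v 0 ^ (r + 1) / (r + 1).factorial - v m ^ (r + 1) / (r + 1).factorial
        - (v 0 - v m - b m) * (v m ^ r / r.factorial) := by
    induction m with
    | zero => simp [hb0]
    | succ m ih =>
      rw [Finset.sum_range_succ]
      have h1 := ih (fun k hk => hanti k (by omega)) (fun k hk => hv k (by omega))
        (fun k hk => hb k (by omega))
      have h2 := sub_mul_pow_div_factorial_le (hv (m + 1) le_rfl) (hanti m (by omega)) r
      have h3 : v (m + 1) ^ r / r.factorial ≤ v m ^ r / r.factorial := by
        gcongr
        · exact hv (m + 1) le_rfl
        · exact hanti m (by omega)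
      have h4 := mul_le_mul_of_nonneg_left h3
        (by linarith [hb m (by omega)] : 0 ≤ v 0 - b m - v m)
      linarith
  have h1 : 0 ≤ v m ^ (r + 1) / ((r + 1).factorial : ℝ) := by
    have := hv m le_rfl
    positivity
  have h2 : 0 ≤ (v 0 - v m - b m) * (v m ^ r / r.factorial) := by
    have := hv m le_rfl
    have := hb m le_rfl
    refine mul_nonneg (by linarith) (by positivity)
  linarith

lemma log_two_le_log_one_div {t : ℝ} (ht : 0 < t) (ht2 : t ≤ 1 / 2) :
    Real.log 2 ≤ Real.log (1 / t) :=
  Real.log_le_log (by norm_num) (by rw [le_div_iff₀ ht]; linarith)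

lemma log_le_half {z : ℝ} (hz : 0 < z) : Real.log z ≤ z / 2 := by
  have h := Real.log_le_sub_one_of_pos (half_pos hz)
  rw [Real.log_div hz.ne' two_ne_zero] at h
  linarith [Real.log_two_lt_d9]

lemma log_four_div {t : ℝ} (ht : 0 < t) :
    Real.log (4 / t) = Real.log (1 / t) + 2 * Real.log 2 := by
  rw [div_eq_mul_one_div, Real.log_mul (by norm_num) (by positivity)]
  have : Real.log 4 = 2 * Real.log 2 := by
    rw [show (4 : ℝ) = 2 ^ 2 by norm_num, Real.log_pow]; norm_num
  rw [this]; ring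

lemma seven_tenths_le_loglog {t : ℝ} (ht : 0 < t) (ht2 : t ≤ 1 / 2) :
    0.7 ≤ Real.log (Real.log (4 / t)) := by
  have h1 := log_two_le_log_one_div ht ht2
  have h2 := Real.log_two_gt_d9
  have h3 : 2.07 ≤ Real.log (4 / t) := by rw [log_four_div ht]; linarith
  have h4 : Real.log (2 * (1 + 0.035)) ≤ Real.log (Real.log (4 / t)) :=
    Real.log_le_log (by norm_num) (by linarith)
  rw [Real.log_mul (by norm_num) (by norm_num)] at h4
  have h5 := Real.one_sub_inv_le_log_of_pos (by norm_num : (0 : ℝ) < 1 + 0.035)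
  norm_num at h4 h5 h2 ⊢
  linarith

/-- The ratio `log (1 / t) / max (log (1 / s)) (log log (4 / t))` stays away from `0`. -/
lemma half_le_log_ratio {t s : ℝ} (ht : 0 < t) (hts : t ≤ s) (hs : s ≤ 1 / 2) :
    1 / 2 ≤ Real.log (1 / t) / max (Real.log (1 / s)) (Real.log (Real.log (4 / t))) := by
  have ht2 := hts.trans hs
  have h1 := log_two_le_log_one_div ht ht2
  have h2 := Real.log_two_gt_d9
  have h2' := Real.log_two_lt_d9
  have h3 := seven_tenths_le_loglog ht ht2
  have h4 : Real.log (1 / s) ≤ Real.log (1 / t) :=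
    Real.log_le_log (by have := ht.trans_le hts; positivity) (one_div_le_one_div_of_le ht hts)
  have h5 : 0 < Real.log (4 / t) := by rw [log_four_div ht]; linarith
  have h6 := Real.log_le_sub_one_of_pos h5
  rw [log_four_div ht] at h6
  have h7 : 0 < max (Real.log (1 / s)) (Real.log (Real.log (4 / t))) :=
    lt_of_lt_of_le (by norm_num at h3 ⊢; linarith) (le_max_right _ _)
  rw [le_div_iff₀ h7]
  have : max (Real.log (1 / s)) (Real.log (Real.log (4 / t))) ≤ 2 * Real.log (1 / t) := by
    rw [← log_four_div ht] at h6
    refine max_le (by linarith) ?_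
    rw [log_four_div ht] at h6 ⊢
    linarith
  linarith

/-- The number of excursions that the main estimate needs. When `s` is small against
`1 / log (4 / t)`, the power of the odds `s / (1 - s)` does the work, otherwise the factorial. -/
lemma odds_pow_div_factorial_le {t s : ℝ} (ht : 0 < t) (hts : t ≤ s) (hs : s ≤ 1 / 2) {K : ℕ}
    (hK : 18 * (Real.log (1 / t) / max (Real.log (1 / s)) (Real.log (Real.log (4 / t)))) ≤ K) :
    (s / (1 - s)) ^ K / K.factorial ≤ t / 2 := by
  have ht2 := hts.trans hs
  have hs0 := ht.trans_le hts
  have hx := log_two_le_log_one_div ht ht2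
  have hy := log_two_le_log_one_div hs0 hs
  have h2 := Real.log_two_gt_d9
  have h2' := Real.log_two_lt_d9
  have hll := seven_tenths_le_loglog ht ht2
  have hl := log_four_div ht
  have hK0 : (0 : ℝ) < K := by linarith [half_le_log_ratio ht hts hs]
  have hlogs : Real.log (1 / s) = - Real.log s := by rw [one_div, Real.log_inv]
  have hlogt : Real.log (1 / t) = - Real.log t := by rw [one_div, Real.log_inv]
  have hfac : (1 : ℝ) ≤ K.factorial := by exact_mod_cast Nat.factorial_pos K
  -- both cases end with a bound by `exp (-2 log (1 / t)) = t ^ 2`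
  have hfin : Real.exp (-(2 * Real.log (1 / t))) ≤ t / 2 := by
    rw [hlogt]
    have : -(2 * -Real.log t) = Real.log t + Real.log t := by ring
    rw [this, Real.exp_add, Real.exp_log ht]
    nlinarith
  refine le_trans ?_ hfin
  set x := Real.log (1 / t) with hxdef
  set y := Real.log (1 / s) with hydef
  set l := Real.log (4 / t) with hldef
  have hm : 0 < max y (Real.log l) := lt_of_lt_of_le (by linarith) (le_max_left _ _)
  have hKm : 18 * x ≤ K * max y (Real.log l) := by
    rw [mul_div_assoc', div_le_iff₀ hm] at hK
    exact hK
  have hr1 : s / (1 - s) ≤ 1 := by rw [div_le_one (by linarith)]; linarith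
  have hr0 : 0 ≤ s / (1 - s) := div_nonneg hs0.le (by linarith)
  by_cases hcase : Real.log l ≤ y ∧ 2 * Real.log 2 ≤ y
  · rw [max_eq_left hcase.1] at hKm
    have h3 : s / (1 - s) ≤ Real.exp (-(y / 2)) := by
      have h4 : s / (1 - s) ≤ 2 * s := by
        rw [div_le_iff₀ (by linarith)]; nlinarith
      have h5 : 2 * s = Real.exp (Real.log 2 - y) := by
        rw [hlogs, sub_neg_eq_add, Real.exp_add, Real.exp_log two_pos, Real.exp_log hs0]
      rw [h5] at h4
      exact h4.trans (Real.exp_le_exp.2 (by linarith [hcase.2]))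
    calc (s / (1 - s)) ^ K / K.factorial ≤ (s / (1 - s)) ^ K := div_le_self (by positivity) hfac
      _ ≤ Real.exp (-(y / 2)) ^ K := by gcongr
      _ = Real.exp (K * -(y / 2)) := by rw [← Real.exp_nat_mul]
      _ ≤ Real.exp (-(2 * x)) := Real.exp_le_exp.2 (by linarith)
  · have hmax : max y (Real.log l) ≤ 2 * Real.log l := by
      refine max_le ?_ (by linarith)
      by_contra hcon
      refine hcase ⟨by linarith, ?_⟩
      norm_num at hll
      linarith
    have hL : 0 < Real.log l := by norm_num at hll; linarith
    have hl0 : 0 < l := by linarith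
    have h3 : 9 * x ≤ K * Real.log l := by nlinarith
    have hlogK : Real.log l / 2 + 1 ≤ Real.log K := by
      have h4 : Real.exp 1 * (l / Real.log l) ≤ K := by
        rw [mul_div_assoc', div_le_iff₀ hL]
        have := Real.exp_one_lt_d9
        nlinarith
      have h5 := Real.log_le_log (by positivity) h4
      rw [Real.log_mul (by positivity) (by positivity), Real.log_exp,
        Real.log_div hl0.ne' hL.ne'] at h5
      linarith [log_le_half hL]
    have h6 : (1 : ℝ) / K.factorial ≤ Real.exp (K - K * Real.log K) := by
      have h7 := Real.pow_div_factorial_le_exp (K : ℝ) hK0.le K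
      have h8 : (K : ℝ) ^ K = Real.exp (K * Real.log K) := by
        rw [Real.exp_nat_mul, Real.exp_log hK0]
      rw [Real.exp_sub, ← h8, le_div_iff₀ (by positivity)]
      calc (1 : ℝ) / K.factorial * K ^ K = K ^ K / K.factorial := by ring
        _ ≤ _ := h7
    calc (s / (1 - s)) ^ K / K.factorial ≤ 1 / K.factorial := by
          gcongr
          exact pow_le_one₀ hr0 hr1
      _ ≤ _ := h6
      _ ≤ _ := Real.exp_le_exp.2 (by nlinarith)

/-! ### Displacement in a strongly left-invariant semigroup -/

section Displacement

variable {G : Type*} [Semigroup G] [MetricSpace G]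

/-- The common value `d(b, b²)` of the distances `d(a, ab)`, `a ∈ G`. It replaces the distance from
`b` to the identity, which `G` need not have. -/
noncomputable def displacement (b : G) : ℝ := dist b (b * b)

variable [IsStronglyLeftInvariant G]

lemma dist_self_mul_eq_displacement (a b : G) : dist a (a * b) = displacement b :=
  IsStronglyLeftInvariant.dist_self_mul' a b

lemma displacement_mul_le (a b : G) :
    displacement (a * b) ≤ displacement a + displacement b := by
  rw [← dist_self_mul_eq_displacement a (a * b), ← dist_self_mul_eq_displacement a a,
    ← dist_self_mul_eq_displacement (a * a) b, ← mul_assoc]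
  exact dist_triangle _ _ _

lemma continuous_const_mul_of_isStronglyLeftInvariant (c : G) : Continuous fun g : G => c * g :=
  (Isometry.of_dist_eq fun a b => IsStronglyLeftInvariant.dist_mul_left' a b c).continuous

lemma continuous_displacement : Continuous (displacement : G → ℝ) := by
  rcases isEmpty_or_nonempty G with h | ⟨⟨c⟩⟩
  · exact continuous_of_discreteTopology
  have : (displacement : G → ℝ) = fun g => dist c (c * g) :=
    funext fun g => (dist_self_mul_eq_displacement c g).symm
  rw [this]
  exact continuous_const.dist (continuous_const_mul_of_isStronglyLeftInvariant c)

end Displacement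

section Paths

variable {G : Type*} [Semigroup G]

lemma segProd_mul_segProd (x : ℕ → G) (i k m : ℕ) :
    segProd x i k * segProd x (i + k + 1) m = segProd x i (k + 1 + m) := by
  induction m with
  | zero => rfl
  | succ m ih =>
    change _ * (segProd x (i + k + 1) m * x (i + k + 1 + (m + 1))) =
      segProd x i (k + 1 + m) * x (i + (k + 1 + m + 1))
    rw [← mul_assoc, ih]
    congr 2
    omega

variable [MetricSpace G]

/-- The path `x i, x i * x (i + 1), …` up to the factor `x (n - 1)` makes `r` successive excursions:
it leaves the `a`-neighbourhood of its start, is restarted right after the first exit, and so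
on, `r` times. -/
def HasExcursions (x : ℕ → G) (n : ℕ) (a : ℝ) : ℕ → ℕ → Prop
  | 0, _ => True
  | r + 1, i => ∃ k, i + k < n ∧ (∀ l < k, displacement (segProd x i l) ≤ a) ∧
      a < displacement (segProd x i k) ∧ HasExcursions x n a r (i + k + 1)

/-- Between two excursions the path moves by at most `2 * A`, and the exit itself costs one more
step of size at most `A`. -/
lemma displacement_segProd_le_of_not_hasExcursions [IsStronglyLeftInvariant G] {x : ℕ → G} {n : ℕ}
    {A : ℝ} (hA : 0 ≤ A) (hx : ∀ k < n, displacement (x k) ≤ A) (r : ℕ) :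
    ∀ i k, i + k < n → ¬ HasExcursions x n (2 * A) r i →
      displacement (segProd x i k) ≤ 3 * r * A := by
  induction r with
  | zero => intro i k _ h; exact absurd trivial h
  | succ r ih =>
    intro i k hik h
    have hr : 0 ≤ r * A := by positivity
    push_cast
    by_contra! hcon
    have hex : ∃ l, l ≤ k ∧ 2 * A < displacement (segProd x i l) := ⟨k, le_rfl, by linarith⟩
    classical
    obtain ⟨l, ⟨hlk, hl⟩, hmin⟩ : ∃ l, (l ≤ k ∧ 2 * A < displacement (segProd x i l)) ∧
        ∀ l' < l, displacement (segProd x i l') ≤ 2 * A :=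
      ⟨Nat.find hex, Nat.find_spec hex, fun l' hl' => by
        by_contra! hc
        exact Nat.find_min hex hl' ⟨hl'.le.trans (Nat.find_spec hex).1, hc⟩⟩
    have hl3 : displacement (segProd x i l) ≤ 3 * A := by
      cases l with
      | zero =>
        have := hx i (by omega)
        change displacement (x i) ≤ _
        linarith
      | succ l =>
        have h1 := displacement_mul_le (segProd x i l) (x (i + (l + 1)))
        have h2 := hmin l (by omega)
        have h3 := hx (i + (l + 1)) (by omega)
        change displacement (segProd x i l * x (i + (l + 1))) ≤ _
        linarith
    have hnot : ¬ HasExcursions x n (2 * A) r (i + l + 1) := fun hc =>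
      h ⟨l, by omega, hmin, hl, hc⟩
    rcases hlk.eq_or_lt with rfl | hlt
    · linarith
    · obtain ⟨m, rfl⟩ : ∃ m, k = l + 1 + m := ⟨k - (l + 1), by omega⟩
      have h1 := ih (i + l + 1) m (by omega) hnot
      have h2 := displacement_mul_le (segProd x i l) (segProd x (i + l + 1) m)
      rw [segProd_mul_segProd] at h2
      linarith

end Paths

/-! ### The law of the number of excursions -/

section SigmaAlgebras

variable {Ω G : Type*} [mG : MeasurableSpace G]

/-- The σ-algebra generated by those of the variables `X 0, …, X (n - 1)` whose index lies in
`I`. -/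
abbrev sigmaOf (X : ℕ → Ω → G) (n : ℕ) (I : Set (Fin n)) : MeasurableSpace Ω :=
  ⨆ a ∈ I, MeasurableSpace.comap (X a) mG

lemma sigmaOf_mono (X : ℕ → Ω → G) (n : ℕ) {I J : Set (Fin n)} (h : I ⊆ J) :
    sigmaOf X n I ≤ sigmaOf X n J :=
  biSup_mono h

lemma sigmaOf_le [mΩ : MeasurableSpace Ω] {X : ℕ → Ω → G} {n : ℕ}
    (hX : ∀ i < n, Measurable (X i)) (I : Set (Fin n)) : sigmaOf X n I ≤ mΩ :=
  iSup₂_le fun a _ => (hX a a.2).comap_le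

/-- Events of the past before `i` are independent of events of the future from `i` on. -/
lemma measureReal_inter_eq_mul [MeasurableSpace Ω] {μ : Measure Ω} {X : ℕ → Ω → G} {n : ℕ}
    (hX : ∀ i < n, Measurable (X i)) (hind : iIndepFun (fun i : Fin n => X i) μ) (i : ℕ)
    {s t : Set Ω} (hs : MeasurableSet[sigmaOf X n {a | a.val < i}] s)
    (ht : MeasurableSet[sigmaOf X n {a | i ≤ a.val}] t) :
    μ.real (s ∩ t) = μ.real s * μ.real t := by
  rw [iIndepFun_iff_iIndep] at hind
  have hdisj : Disjoint {a : Fin n | a.val < i} {a : Fin n | i ≤ a.val} := by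
    rw [Set.disjoint_left]
    exact fun a (ha : a.val < i) (hb : i ≤ a.val) => absurd ha (not_lt.2 hb)
  have h := (Indep_iff _ _ _).1
    (indep_iSup_of_disjoint (fun a : Fin n => (hX a a.2).comap_le) hind hdisj) s t hs ht
  simp only [Measure.real, h, ENNReal.toReal_mul]

lemma measurable_segProd_sigmaOf [Semigroup G] {X : ℕ → Ω → G} {n : ℕ} (hprod : ProductsMeasurable X n)
    {i k : ℕ} (hik : i + k < n) {I : Set (Fin n)} (hI : ∀ a : Fin n, i ≤ a → a ≤ i + k → a ∈ I) :
    Measurable[sigmaOf X n I] fun ω => segProd (fun l => X l ω) i k := by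
  refine (hprod i k hik).mono (iSup₂_le fun l hl => ?_) le_rfl
  rw [Finset.mem_Icc] at hl
  exact le_iSup₂_of_le (f := fun (a : Fin n) (_ : a ∈ I) => MeasurableSpace.comap (X a) mG)
    ⟨l, by omega⟩ (hI _ hl.1 hl.2) le_rfl

end SigmaAlgebras

section Probability

variable {Ω G : Type*} [Semigroup G] [MetricSpace G]

/-- The event that the first `i` partial products stay in the closed ball of radius `A` around `z₁`
after translation by `z₀`. -/
def staySet (z₀ z₁ : G) (X : ℕ → Ω → G) (A : ℝ) (i : ℕ) : Set Ω :=
  {ω | ∀ k < i, dist z₁ (z₀ * partialProd X k ω) ≤ A}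

/-- The event that one of the products of at most `m` factors starting with `X i` has displacement
larger than `a`. -/
def escapeSet (X : ℕ → Ω → G) (a : ℝ) (i m : ℕ) : Set Ω :=
  {ω | ∃ k < m, a < displacement (segProd (fun l => X l ω) i k)}

/-- The event that there are `r` successive excursions from `X i` on. -/
def excursionSet (X : ℕ → Ω → G) (n : ℕ) (a : ℝ) (r i : ℕ) : Set Ω :=
  {ω | HasExcursions (fun l => X l ω) n a r i}

lemma staySet_anti (z₀ z₁ : G) (X : ℕ → Ω → G) (A : ℝ) {i j : ℕ} (hij : i ≤ j) :
    staySet z₀ z₁ X A j ⊆ staySet z₀ z₁ X A i :=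
  fun _ h k hk => h k (hk.trans_le hij)

lemma escapeSet_mono (X : ℕ → Ω → G) (a : ℝ) (i : ℕ) {m m' : ℕ} (h : m ≤ m') :
    escapeSet X a i m ⊆ escapeSet X a i m' :=
  fun _ ⟨k, hk, hk'⟩ => ⟨k, hk.trans_le h, hk'⟩

lemma excursionSet_succ_subset (X : ℕ → Ω → G) (n : ℕ) (a : ℝ) (r i : ℕ) :
    excursionSet X n a (r + 1) i ⊆ ⋃ k ∈ Finset.range (n - i),
      (escapeSet X a i (k + 1) \ escapeSet X a i k) ∩ excursionSet X n a r (i + k + 1) := by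
  rintro ω ⟨k, hk, hmin, hexit, hrest⟩
  refine Set.mem_biUnion (Finset.mem_coe.2 (Finset.mem_range.2 (by omega : k < n - i)))
    ⟨⟨⟨k, k.lt_succ_self, hexit⟩, ?_⟩, hrest⟩
  rintro ⟨l, hl, hl'⟩
  exact absurd (hmin l hl) (not_le.2 hl')

/-- A path that has stayed in the ball and then moves by more than the diameter has left it. -/
lemma staySet_inter_escapeSet_subset [IsStronglyLeftInvariant G] {z₀ z₁ : G} {X : ℕ → Ω → G}
    {A : ℝ} (hz : dist z₁ z₀ ≤ A) (i m : ℕ) :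
    staySet z₀ z₁ X A i ∩ escapeSet X (2 * A) i m ⊆
      staySet z₀ z₁ X A i \ staySet z₀ z₁ X A (i + m) := by
  rintro ω ⟨hstay, k, hk, hesc⟩
  refine ⟨hstay, fun hc => ?_⟩
  have hend := hc (i + k) (by omega)
  cases i with
  | zero =>
    have h1 := dist_triangle_left z₀ (z₀ * segProd (fun l => X l ω) 0 k) z₁
    rw [dist_self_mul_eq_displacement] at h1
    rw [Nat.zero_add] at hend
    change dist z₁ (z₀ * segProd (fun l => X l ω) 0 k) ≤ A at hend
    linarith
  | succ i =>
    have h0 := hstay i i.lt_succ_self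
    have h1 := dist_triangle_left (z₀ * partialProd X i ω)
      (z₀ * partialProd X i ω * segProd (fun l => X l ω) (i + 1) k) z₁
    have h2 : partialProd X i ω * segProd (fun l => X l ω) (i + 1) k =
        partialProd X (i + 1 + k) ω := by
      have := segProd_mul_segProd (fun l => X l ω) 0 i k
      rw [Nat.zero_add, add_right_comm] at this
      rw [partialProd, partialProd, this, add_right_comm]
    rw [dist_self_mul_eq_displacement, mul_assoc, h2] at h1
    linarith

variable [mG : MeasurableSpace G] [IsStronglyLeftInvariant G] [BorelSpace G]

lemma measurableSet_staySet {X : ℕ → Ω → G} {n : ℕ} (hprod : ProductsMeasurable X n)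
    (z₀ z₁ : G) (A : ℝ) {i : ℕ} (hi : i ≤ n) :
    MeasurableSet[sigmaOf X n {a | a.val < i}] (staySet z₀ z₁ X A i) := by
  have : staySet z₀ z₁ X A i = ⋂ k, ⋂ (_ : k < i),
      {ω | dist z₁ (z₀ * partialProd X k ω) ≤ A} := by
    ext ω; simp [staySet]
  rw [this]
  refine @MeasurableSet.iInter _ _ (_) _ _ fun k => @MeasurableSet.iInter _ _ (_) _ _ fun hk => ?_
  have hdist : Measurable fun g : G => dist z₁ (z₀ * g) :=
    (continuous_const.dist (continuous_const_mul_of_isStronglyLeftInvariant z₀)).measurable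
  exact hdist.comp (measurable_segProd_sigmaOf hprod (i := 0) (k := k) (by omega) fun a _ ha => by
    simp only [Set.mem_ofPred_eq]; omega) measurableSet_Iic

lemma measurableSet_lt_displacement_segProd {X : ℕ → Ω → G} {n : ℕ}
    (hprod : ProductsMeasurable X n) (a : ℝ) {i k : ℕ} (hik : i + k < n) {I : Set (Fin n)}
    (hI : ∀ b : Fin n, i ≤ b → b ≤ i + k → b ∈ I) :
    MeasurableSet[sigmaOf X n I] {ω | a < displacement (segProd (fun l => X l ω) i k)} := by
  have h : Measurable (displacement : G → ℝ) := continuous_displacement.measurable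
  exact h.comp (measurable_segProd_sigmaOf hprod hik hI) measurableSet_Ioi

lemma measurableSet_escapeSet {X : ℕ → Ω → G} {n : ℕ} (hprod : ProductsMeasurable X n)
    (a : ℝ) {i m : ℕ} (him : i + m ≤ n) {I : Set (Fin n)}
    (hI : ∀ b : Fin n, i ≤ b → b < i + m → b ∈ I) :
    MeasurableSet[sigmaOf X n I] (escapeSet X a i m) := by
  have : escapeSet X a i m = ⋃ k, ⋃ (_ : k < m),
      {ω | a < displacement (segProd (fun l => X l ω) i k)} := by
    ext ω; simp [escapeSet]
  rw [this]
  refine @MeasurableSet.iUnion _ _ (_) _ _ fun k => @MeasurableSet.iUnion _ _ (_) _ _ fun hk => ?_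
  exact measurableSet_lt_displacement_segProd hprod a (by omega) fun b h1 h2 => hI b h1 (by omega)

lemma measurableSet_excursionSet {X : ℕ → Ω → G} {n : ℕ} (hprod : ProductsMeasurable X n)
    (a : ℝ) (r : ℕ) : ∀ i : ℕ,
    MeasurableSet[sigmaOf X n {b | i ≤ b.val}] (excursionSet X n a r i) := by
  induction r with
  | zero => intro i; exact @MeasurableSet.univ _ (_)
  | succ r ih =>
    intro i
    have : excursionSet X n a (r + 1) i = ⋃ k, ⋃ (_ : i + k < n),
        (⋂ l, ⋂ (_ : l < k), {ω | a < displacement (segProd (fun l => X l ω) i l)}ᶜ) ∩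
        ({ω | a < displacement (segProd (fun l => X l ω) i k)} ∩
          excursionSet X n a r (i + k + 1)) := by
      ext ω; simp [excursionSet, HasExcursions, and_left_comm]
    rw [this]
    refine @MeasurableSet.iUnion _ _ (_) _ _ fun k =>
      @MeasurableSet.iUnion _ _ (_) _ _ fun hk => ?_
    refine @MeasurableSet.inter _ (_) _ _ ?_ (@MeasurableSet.inter _ (_) _ _ ?_ ?_)
    · refine @MeasurableSet.iInter _ _ (_) _ _ fun l =>
        @MeasurableSet.iInter _ _ (_) _ _ fun hl => @MeasurableSet.compl _ _ (_) ?_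
      exact measurableSet_lt_displacement_segProd hprod a (by omega) fun b h1 _ => h1
    · exact measurableSet_lt_displacement_segProd hprod a hk fun b h1 _ => h1
    · refine sigmaOf_mono X n (fun b hb => ?_) _ (ih (i + k + 1))
      simp only [Set.mem_ofPred_eq] at hb ⊢
      omega

variable [MeasurableSpace Ω] {μ : Measure Ω} [IsProbabilityMeasure μ] {X : ℕ → Ω → G} {n : ℕ}

/-- By independence, an escape after time `i` has a probability comparable to the probability that
the path leaves the ball after time `i`. -/
lemma measureReal_escapeSet_mul_le (hX : ∀ i < n, Measurable (X i))
    (hind : iIndepFun (fun i : Fin n => X i) μ) (hprod : ProductsMeasurable X n) {z₀ z₁ : G}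
    {A : ℝ} (hz : dist z₁ z₀ ≤ A) {i m : ℕ} (him : i + m ≤ n) :
    μ.real (escapeSet X (2 * A) i m) * μ.real (staySet z₀ z₁ X A n) ≤
      μ.real (staySet z₀ z₁ X A i) - μ.real (staySet z₀ z₁ X A (i + m)) := by
  have h1 : μ.real (staySet z₀ z₁ X A i ∩ escapeSet X (2 * A) i m) =
      μ.real (staySet z₀ z₁ X A i) * μ.real (escapeSet X (2 * A) i m) :=
    measureReal_inter_eq_mul hX hind i (measurableSet_staySet hprod z₀ z₁ A (by omega))
      (measurableSet_escapeSet hprod (2 * A) him fun b hb _ => hb)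
  have h2 : μ.real (staySet z₀ z₁ X A i \ staySet z₀ z₁ X A (i + m)) =
      μ.real (staySet z₀ z₁ X A i) - μ.real (staySet z₀ z₁ X A (i + m)) :=
    measureReal_sdiff (staySet_anti z₀ z₁ X A (Nat.le_add_right i m))
      (sigmaOf_le hX _ _ (measurableSet_staySet hprod z₀ z₁ A him))
  rw [← h2]
  calc _ ≤ μ.real (staySet z₀ z₁ X A i) * μ.real (escapeSet X (2 * A) i m) := by
        rw [mul_comm]
        gcongr
        · exact measure_ne_top _ _
        · exact staySet_anti z₀ z₁ X A (by omega)
    _ = _ := h1.symm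
    _ ≤ _ := measureReal_mono (staySet_inter_escapeSet_subset hz i m)

/-- The probability of `r` excursions is at most the `r`-th divided power of the odds of leaving the
ball. -/
lemma measureReal_excursionSet_le (hX : ∀ i < n, Measurable (X i))
    (hind : iIndepFun (fun i : Fin n => X i) μ) (hprod : ProductsMeasurable X n) {z₀ z₁ : G}
    {A : ℝ} (hz : dist z₁ z₀ ≤ A) (hq : 0 < μ.real (staySet z₀ z₁ X A n)) (r : ℕ) :
    ∀ i ≤ n, μ.real (excursionSet X n (2 * A) r i) ≤
      ((μ.real (staySet z₀ z₁ X A i) - μ.real (staySet z₀ z₁ X A n)) /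
        μ.real (staySet z₀ z₁ X A n)) ^ r / r.factorial := by
  induction r with
  | zero => intro i _; simp
  | succ r ih =>
    intro i hi
    set q := μ.real (staySet z₀ z₁ X A n) with hqdef
    let v : ℕ → ℝ := fun k => (μ.real (staySet z₀ z₁ X A (i + k)) - q) / q
    have hmono : ∀ {j k : ℕ}, j ≤ k →
        μ.real (staySet z₀ z₁ X A k) ≤ μ.real (staySet z₀ z₁ X A j) :=
      fun h => measureReal_mono (staySet_anti z₀ z₁ X A h)
    have key := sum_sub_mul_pow_div_factorial_le v
      (fun k => μ.real (escapeSet X (2 * A) i k)) r (n - i)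
      (fun k _ => div_le_div_of_nonneg_right (sub_le_sub_right (hmono (by omega)) _) hq.le)
      (fun k _ => div_nonneg (sub_nonneg.2 (hmono (by omega))) hq.le)
      (by simp [escapeSet])
      (fun k hk => by
        have := measureReal_escapeSet_mul_le (i := i) (m := k) hX hind hprod hz (by omega)
        simp only [v, add_zero]
        rw [← sub_div, sub_sub_sub_cancel_right, le_div_iff₀ hq]
        exact this)
    refine le_trans ?_ key
    refine (measureReal_mono (excursionSet_succ_subset X n (2 * A) r i) (measure_ne_top _ _)).trans
      ((measureReal_biUnion_finset_le _ _).trans (Finset.sum_le_sum fun k hk => ?_))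
    rw [Finset.mem_range] at hk
    have hk' : i + k + 1 ≤ n := by omega
    have hm : ∀ m ≤ k + 1,
        MeasurableSet[sigmaOf X n {b | b.val < i + k + 1}] (escapeSet X (2 * A) i m) :=
      fun m hm => measurableSet_escapeSet hprod (2 * A) (by omega) fun b _ hb => by
        simp only [Set.mem_ofPred_eq]; omega
    have h1 := measureReal_inter_eq_mul hX hind (i + k + 1)
      (@MeasurableSet.diff _ (_) _ _ (hm (k + 1) le_rfl) (hm k (by omega)))
      (measurableSet_excursionSet hprod (2 * A) r (i + k + 1))
    have h2 : μ.real (escapeSet X (2 * A) i (k + 1) \ escapeSet X (2 * A) i k) =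
        μ.real (escapeSet X (2 * A) i (k + 1)) - μ.real (escapeSet X (2 * A) i k) :=
      measureReal_sdiff (escapeSet_mono X _ i k.le_succ) (sigmaOf_le hX _ _ (hm k (by omega)))
    rw [h1, h2]
    refine mul_le_mul_of_nonneg_left (ih (i + k + 1) hk') (sub_nonneg.2 ?_)
    exact measureReal_mono (escapeSet_mono X _ i k.le_succ)

end Probability

/-! ### The tail inequality for the maximum -/

section TailInequality

variable {Ω G : Type*} [Semigroup G] [MetricSpace G]

lemma dist_le_maxU (z₀ z₁ : G) (X : ℕ → Ω → G) {n k : ℕ} (hk : k < n) (ω : Ω) :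
    dist z₁ (z₀ * partialProd X k ω) ≤ maxU z₀ z₁ X n ω :=
  le_ciSup (f := fun k : Fin n => dist z₁ (z₀ * partialProd X k ω))
    (Set.finite_range _).bddAbove ⟨k, hk⟩

lemma dist_le_maxM (z₀ : G) (X : ℕ → Ω → G) {n k : ℕ} (hk : k < n) (ω : Ω) :
    dist z₀ (z₀ * X k ω) ≤ maxM z₀ X n ω :=
  le_ciSup (f := fun k : Fin n => dist z₀ (z₀ * X k ω)) (Set.finite_range _).bddAbove ⟨k, hk⟩

lemma compl_staySet (z₀ z₁ : G) (X : ℕ → Ω → G) (A : ℝ) {n : ℕ} (hn : 1 ≤ n) :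
    (staySet z₀ z₁ X A n)ᶜ = {ω | A < maxU z₀ z₁ X n ω} := by
  have : Nonempty (Fin n) := ⟨⟨0, hn⟩⟩
  ext ω
  simp only [staySet, Set.mem_compl_iff, Set.mem_ofPred_eq, not_forall, not_le, exists_prop]
  constructor
  · rintro ⟨k, hk, h⟩
    exact h.trans_le (dist_le_maxU z₀ z₁ X hk ω)
  · intro h
    obtain ⟨k, hk⟩ := exists_lt_of_lt_ciSup h
    exact ⟨k, k.2, hk⟩

variable [IsStronglyLeftInvariant G]

lemma setOf_lt_maxU_subset {z₀ z₁ : G} {X : ℕ → Ω → G} {n : ℕ} (hn : 1 ≤ n) {A : ℝ}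
    (hA : 0 ≤ A) (hz : dist z₁ z₀ ≤ A) (K : ℕ) :
    {ω | (3 * K + 1) * A < maxU z₀ z₁ X n ω} ⊆
      {ω | A < maxM z₀ X n ω} ∪ excursionSet X n (2 * A) K 0 := by
  intro ω hω
  rw [← compl_staySet z₀ z₁ X _ hn] at hω
  by_contra hcon
  simp only [Set.mem_union, Set.mem_ofPred_eq, not_or, not_lt] at hcon
  refine hω fun k hk => ?_
  have h1 := displacement_segProd_le_of_not_hasExcursions hA (fun l hl => by
    have := dist_le_maxM z₀ X hl ω
    rw [dist_self_mul_eq_displacement] at this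
    exact this.trans hcon.1) K 0 k (by omega) hcon.2
  have h2 := dist_triangle z₁ z₀ (z₀ * partialProd X k ω)
  rw [dist_self_mul_eq_displacement] at h2
  rw [← partialProd] at h1
  linarith

variable [MeasurableSpace G] [BorelSpace G] [MeasurableSpace Ω] {μ : Measure Ω}
  [IsProbabilityMeasure μ] {X : ℕ → Ω → G} {n : ℕ}

/-- A Hoffmann-Jørgensen inequality with a factorial: if `U_n` exceeds `A` with probability at most
`s`, then it exceeds a large multiple of `A` only through a big increment or through `K` successive
excursions. -/
lemma measureReal_lt_maxU_le (hn : 1 ≤ n) (hX : ∀ i < n, Measurable (X i))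
    (hind : iIndepFun (fun i : Fin n => X i) μ) (hprod : ProductsMeasurable X n) {z₀ z₁ : G}
    {A s : ℝ} (hA : 0 ≤ A) (hz : dist z₁ z₀ ≤ A) (hs : s < 1)
    (hU : μ.real {ω | A < maxU z₀ z₁ X n ω} ≤ s) (K : ℕ) :
    μ.real {ω | (3 * K + 1) * A < maxU z₀ z₁ X n ω} ≤
      μ.real {ω | A < maxM z₀ X n ω} + (s / (1 - s)) ^ K / K.factorial := by
  have hmeas := sigmaOf_le hX _ _ (measurableSet_staySet hprod z₀ z₁ A le_rfl)
  rw [← compl_staySet z₀ z₁ X A hn, probReal_compl_eq_one_sub hmeas] at hU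
  have hstart : μ.real (staySet z₀ z₁ X A 0) = 1 := by simp [staySet]
  have h1 := measureReal_excursionSet_le (n := n) hX hind hprod hz (by linarith) K 0 n.zero_le
  rw [hstart] at h1
  refine (measureReal_mono (setOf_lt_maxU_subset hn hA hz K)).trans
    ((measureReal_union_le _ _).trans ?_)
  gcongr
  refine h1.trans ?_
  have hle : μ.real (staySet z₀ z₁ X A n) ≤ 1 := measureReal_le_one
  have hpos : 0 < μ.real (staySet z₀ z₁ X A n) := by linarith
  have hodds : (1 - μ.real (staySet z₀ z₁ X A n)) / μ.real (staySet z₀ z₁ X A n) ≤ s / (1 - s) :=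
    div_le_div₀ (by linarith) hU (by linarith) (by linarith)
  have hodds0 := div_nonneg (sub_nonneg.2 hle) hpos.le
  gcongr

end TailInequality

/-! ### Decreasing rearrangements -/

section Rearrangement

variable {Ω : Type*} [MeasurableSpace Ω] {μ : Measure Ω} {Z : Ω → ℝ} {t : ℝ} {y : ℝ≥0}

lemma decRearrangement_le_of_measure_le (h : μ {ω | (y : ℝ) < Z ω} ≤ ENNReal.ofReal t) :
    decRearrangement μ Z t ≤ y := by
  refine iSup₂_le fun y' hy' => ?_
  by_contra! hcon
  refine absurd (hy'.trans_le ((measure_mono fun ω hω => ?_).trans h)) (lt_irrefl _)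
  have : (y : ℝ) < y' := by exact_mod_cast hcon
  exact this.trans hω

/-- The supremum defining `Z*(t)` is not attained, by continuity of `μ` from below. -/
lemma measure_le_of_decRearrangement_le (h : decRearrangement μ Z t ≤ y) :
    μ {ω | (y : ℝ) < Z ω} ≤ ENNReal.ofReal t := by
  have hmono : Monotone fun m : ℕ => {ω | ((y + 1 / (m + 1) : ℝ≥0) : ℝ) < Z ω} := by
    intro m m' hm ω (hω : ((y + 1 / (m + 1) : ℝ≥0) : ℝ) < Z ω)
    refine lt_of_le_of_lt ?_ hω
    rw [NNReal.coe_le_coe]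
    gcongr
  have hunion : {ω | (y : ℝ) < Z ω} = ⋃ m : ℕ, {ω | ((y + 1 / (m + 1) : ℝ≥0) : ℝ) < Z ω} := by
    ext ω
    simp only [Set.mem_ofPred_eq, Set.mem_iUnion]
    constructor
    · intro hω
      obtain ⟨m, hm⟩ := exists_nat_one_div_lt (sub_pos.2 hω)
      exact ⟨m, by push_cast; linarith⟩
    · rintro ⟨m, hm⟩
      refine lt_of_le_of_lt ?_ hm
      rw [NNReal.coe_le_coe]
      exact le_self_add
  rw [hunion, hmono.measure_iUnion]
  refine iSup_le fun m => ?_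
  by_contra! hcon
  have h1 : ((y + 1 / (m + 1) : ℝ≥0) : ℝ≥0∞) ≤ y :=
    (le_iSup₂ (f := fun (y : ℝ≥0) (_ : ENNReal.ofReal t < μ {ω | (y : ℝ) < Z ω}) => (y : ℝ≥0∞))
      _ hcon).trans h
  rw [ENNReal.coe_le_coe] at h1
  have h2 : (0 : ℝ≥0) < 1 / (m + 1) := by positivity
  exact absurd h1 (not_le.2 (lt_add_of_pos_right y h2))

lemma logFactor_ne_zero {t s : ℝ} (ht : 0 ≤ t) (hts : t ≤ s) (hs : s ≤ 1 / 2) :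
    logFactor t s ≠ 0 := by
  unfold logFactor
  split_ifs with h
  · exact ENNReal.top_ne_zero
  · have := half_le_log_ratio (lt_of_le_of_ne ht (Ne.symm h)) hts hs
    exact (ENNReal.ofReal_pos.2 (by linarith)).ne'

end Rearrangement

theorem proposition3p4 :
    ∃ c₁ : ℝ, 0 < c₁ ∧
      ∀ (t s : ℝ), 0 ≤ t → t ≤ s → s ≤ 1 / 2 →
      ∀ (G : Type*) [Semigroup G] [MetricSpace G] [IsStronglyLeftInvariant G]
        [TopologicalSpace.SeparableSpace G] [MeasurableSpace G] [BorelSpace G]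
        (z₀ z₁ : G)
        (Ω : Type*) [MeasurableSpace Ω] (μ : Measure Ω) [IsProbabilityMeasure μ]
        (n : ℕ) (X : ℕ → Ω → G),
        1 ≤ n →
        (∀ i < n, Measurable (X i)) →
        iIndepFun (fun i : Fin n => X i) μ →
        ProductsMeasurable X n →
        decRearrangement μ (maxU z₀ z₁ X n) t ≤
          ENNReal.ofReal c₁ * logFactor t s *
            (decRearrangement μ (maxU z₀ z₁ X n) s +
              decRearrangement μ (maxM z₀ X n) (t / 2)) := by
  refine ⟨62, by norm_num, ?_⟩
  intro t s ht hts hs G _ _ _ _ _ _ z₀ z₁ Ω _ μ _ n X hn hX hind hprod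
  have hfac : ENNReal.ofReal 62 * logFactor t s ≠ 0 :=
    mul_ne_zero (ENNReal.ofReal_pos.2 (by norm_num)).ne' (logFactor_ne_zero ht hts hs)
  by_cases hfin : decRearrangement μ (maxU z₀ z₁ X n) s +
      decRearrangement μ (maxM z₀ X n) (t / 2) = ∞
  · rw [hfin, ENNReal.mul_top hfac]
    exact le_top
  obtain ⟨hafin, hbfin⟩ := ENNReal.add_ne_top.1 hfin
  obtain ⟨a, ha⟩ : ∃ a : ℝ≥0, (a : ℝ≥0∞) = _ := ⟨_, ENNReal.coe_toNNReal hafin⟩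
  obtain ⟨b, hb⟩ : ∃ b : ℝ≥0, (b : ℝ≥0∞) = _ := ⟨_, ENNReal.coe_toNNReal hbfin⟩
  have hU := ENNReal.toReal_le_of_le_ofReal (ht.trans hts) (measure_le_of_decRearrangement_le ha.ge)
  have hM := ENNReal.toReal_le_of_le_ofReal (by linarith) (measure_le_of_decRearrangement_le hb.ge)
  rw [← Measure.real] at hU hM
  have hA : (0 : ℝ) ≤ a + b := by positivity
  -- `U_n ≤ a` and `M_n ≤ b` hold simultaneously at some point, which locates `z₁` near `z₀`
  have hz : dist z₁ z₀ ≤ a + b := by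
    have hne : {ω | (a : ℝ) < maxU z₀ z₁ X n ω} ∪ {ω | (b : ℝ) < maxM z₀ X n ω} ≠ Set.univ := by
      intro h
      have h1 := measureReal_union_le (μ := μ) {ω | (a : ℝ) < maxU z₀ z₁ X n ω}
        {ω | (b : ℝ) < maxM z₀ X n ω}
      rw [h, probReal_univ] at h1
      linarith
    obtain ⟨ω, hω⟩ := (Set.ne_univ_iff_exists_notMem _).1 hne
    simp only [Set.mem_union, Set.mem_ofPred_eq, not_or, not_lt] at hω
    have h1 := dist_le_maxU z₀ z₁ X hn ω
    have h2 := dist_le_maxM z₀ X hn ω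
    have h3 := dist_triangle_right z₁ z₀ (z₀ * X 0 ω)
    change dist z₁ (z₀ * X 0 ω) ≤ _ at h1
    linarith [hω.1, hω.2]
  have hUA : μ.real {ω | (a + b : ℝ) < maxU z₀ z₁ X n ω} ≤ s :=
    (measureReal_mono fun ω (hω : (a + b : ℝ) < _) =>
      show (a : ℝ) < _ from (le_add_of_nonneg_right b.2).trans_lt hω).trans hU
  have hMA : μ.real {ω | (a + b : ℝ) < maxM z₀ X n ω} ≤ t / 2 :=
    (measureReal_mono fun ω (hω : (a + b : ℝ) < _) =>
      show (b : ℝ) < _ from (le_add_of_nonneg_left a.2).trans_lt hω).trans hM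
  have htail := measureReal_lt_maxU_le hn hX hind hprod hA hz (by linarith) hUA
  rw [← ha, ← hb]
  rcases ht.eq_or_lt with rfl | ht
  · by_cases h0 : a + b = 0
    · -- the odds are at most `1`, so letting `K → ∞` shows that `U_n = 0` almost surely
      have hAzero : (a + b : ℝ) = 0 := by exact_mod_cast h0
      rw [hAzero] at htail hMA
      have hle : ∀ K : ℕ, μ.real {ω | 0 < maxU z₀ z₁ X n ω} ≤ (1 : ℝ) ^ K / K.factorial := by
        intro K
        have h1 := htail K
        rw [mul_zero] at h1
        have h2 : (s / (1 - s)) ^ K / K.factorial ≤ (1 : ℝ) ^ K / K.factorial := by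
          have : s / (1 - s) ≤ 1 := by rw [div_le_one (by linarith)]; linarith
          have : 0 ≤ s / (1 - s) := div_nonneg hts (by linarith)
          gcongr
        linarith
      have hzero := ge_of_tendsto' (FloorSemiring.tendsto_pow_div_factorial_atTop (1 : ℝ)) hle
      refine le_trans (b := ((0 : ℝ≥0) : ℝ≥0∞)) (decRearrangement_le_of_measure_le ?_) (by simp)
      rw [ENNReal.le_ofReal_iff_toReal_le (measure_ne_top _ _) le_rfl]
      exact hzero
    · have : (a : ℝ≥0∞) + b ≠ 0 := by exact_mod_cast h0
      rw [logFactor, if_pos rfl, ENNReal.mul_top (ENNReal.ofReal_pos.2 (by norm_num)).ne',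
        ENNReal.top_mul this]
      exact le_top
  · set R := Real.log (1 / t) / max (Real.log (1 / s)) (Real.log (Real.log (4 / t))) with hR
    have hR2 : 1 / 2 ≤ R := half_le_log_ratio ht hts hs
    have hK := odds_pow_div_factorial_le ht hts hs (Nat.le_ceil (18 * R))
    have hKle : (3 * (⌈18 * R⌉₊ : ℝ) + 1) ≤ 62 * R := by
      linarith [Nat.ceil_lt_add_one (by linarith : 0 ≤ 18 * R)]
    have hy : decRearrangement μ (maxU z₀ z₁ X n) t ≤
        ((3 * ⌈18 * R⌉₊ + 1) * (a + b) : ℝ≥0) := by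
      refine decRearrangement_le_of_measure_le ?_
      rw [ENNReal.le_ofReal_iff_toReal_le (measure_ne_top _ _) ht.le]
      push_cast
      exact (htail ⌈18 * R⌉₊).trans (by linarith)
    refine hy.trans ?_
    rw [logFactor, if_neg ht.ne', ← hR, ← ENNReal.ofReal_mul (by norm_num), ENNReal.coe_mul,
      ENNReal.coe_add a b]
    gcongr
    rw [← ENNReal.ofReal_coe_nnreal]
    refine ENNReal.ofReal_le_ofReal ?_
    push_cast
    exact hKle
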